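/- Let $A=\{a_1<\dots<a_k\}$ be a fixed non-empty finite set of integers. For $n\ge 1$ let $\mathcal E_n$ be the hyperplane arrangement in $\mathbb R^n$ consisting of the hyperplanes $x_i-x_j=a$ for $1\le i<j\le n$ and $a\in A$. Call a subset $\mathcal B\subseteq\mathcal E_n$ central if its hyperplanes have a common point, and for such $\mathcal B$ let $r(\mathcal B)=n-\dim\bigcap\mathcal B$ (so $r(\emptyset)=0$). Let $r(\mathcal E_n)$ be the largest rank $r(\mathcal B)$ of a central subset of $\mathcal E_n$, and let $$\overline\chi_{\mathcal E_n}(q,t)=\sum_{\mathcal B\subseteq\mathcal E_n\text{ central}} q^{\,r(\mathcal E_n)-r(\mathcal B)}(t-1)^{|\mathcal B|}$$ be the coboundary polynomial of $\mathcal E_n$. For every integer $r\ge 0$ let $$A_r(t,x)=\sum_{n\ge 0}\Big(\sum_{f:[n]\to[r]}t^{a(f)}\Big)\frac{x^n}{n!},$$ where $a(f)$ is the number of pairs $(i,j)$ with $1\le i<j\le n$ and $f(i)-f(j)\in A$. Then the formal power series $A_r(t,x)/A_{r-1}(t,x)$ converge as $r\to\infty$, in the sense that for all $a,b$ the coefficient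 of $t^ax^b$ is eventually constant; their limit, whose coefficients are these eventual values, has the form $1+\sum_{n\ge1}F_n(t)x^n$ with $F_n(t)\in\mathbb Q[[t]]$; and $$1+q\sum_{n\ge 1}\overline\chi_{\mathcal E_n}(q,t)\frac{x^n}{n!}=\left(\lim_{r\to\infty}\frac{A_r(t,x)}{A_{r-1}(t,x)}\right)^{q}.$$ This is an identity of formal power series in $t,x$ over $\mathbb Q[q]$, with $q$ an indeterminate and $F^q=\sum_{k\ge 0}\binom qk(F-1)^k$ for a series $F$ of the form $1+\sum_{n\ge1}F_n(t)x^n$. -/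

import Mathlib

open scoped Nat

noncomputable section

/-! ### Hyperplane arrangements in `ℝⁿ`

An arrangement is a finite set of affine subspaces (hyperplanes) of `Fin n → ℝ`. -/

/-- A set of hyperplanes is central if its members have a common point. -/
def IsCentral {n : ℕ} (B : Finset (AffineSubspace ℝ (Fin n → ℝ))) : Prop :=
  ∃ p : Fin n → ℝ, ∀ H ∈ B, p ∈ H

/-- The rank `n - dim ⋂ B` of a central set `B` of hyperplanes. -/
def centralRank {n : ℕ} (B : Finset (AffineSubspace ℝ (Fin n → ℝ))) : ℕ :=
  n - Module.finrank ℝ (⨅ H ∈ B, H : AffineSubspace ℝ (Fin n → ℝ)).direction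

open Classical in
/-- The central subsets of an arrangement. -/
def centralSubsets {n : ℕ} (E : Finset (AffineSubspace ℝ (Fin n → ℝ))) :
    Finset (Finset (AffineSubspace ℝ (Fin n → ℝ))) :=
  E.powerset.filter IsCentral

/-- The rank of an arrangement: the largest rank of a central subset. -/
def arrangementRank {n : ℕ} (E : Finset (AffineSubspace ℝ (Fin n → ℝ))) : ℕ :=
  (centralSubsets E).sup centralRank

/-- The coboundary polynomial `∑ q ^ (r - r(B)) * (t - 1) ^ |B|`, summed over the central
subsets `B` of `E`, as a polynomial in `t` (the outer variable) whose coefficients are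
polynomials in `q` (the inner variable). -/
def coboundaryPolynomial {n : ℕ} (E : Finset (AffineSubspace ℝ (Fin n → ℝ))) :
    Polynomial (Polynomial ℚ) :=
  ∑ B ∈ centralSubsets E,
    Polynomial.C (Polynomial.X ^ (arrangementRank E - centralRank B)) *
      (Polynomial.X - 1) ^ B.card

/-- The hyperplane `x i - x j = c`. -/
def diffHyperplane {n : ℕ} (i j : Fin n) (c : ℝ) : AffineSubspace ℝ (Fin n → ℝ) where
  carrier := {x | x i - x j = c}
  smul_vsub_vadd_mem' := by
    intro s p₁ p₂ p₃ h₁ h₂ h₃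
    simp only [Set.mem_ofPred_eq, vsub_eq_sub, vadd_eq_add, Pi.add_apply, Pi.smul_apply,
      Pi.sub_apply, smul_eq_mul] at *
    linear_combination s * h₁ - s * h₂ + h₃

open Classical in
/-- The arrangement in `ℝⁿ` of all hyperplanes `x i - x j = a` with `i < j` and `a ∈ A`. -/
def deformedBraid (A : Finset ℤ) (n : ℕ) : Finset (AffineSubspace ℝ (Fin n → ℝ)) :=
  ((Finset.univ.filter fun p : Fin n × Fin n => p.1 < p.2) ×ˢ A).image
    fun pa => diffHyperplane pa.1.1 pa.1.2 (pa.2 : ℝ)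

/-! ### Formal power series in `t` and `x`

`PowerSeries (PowerSeries R)` is the ring of formal power series in `t` (inner variable) and
`x` (outer variable); `(F.coeff b).coeff a` is the coefficient of `t ^ a * x ^ b` in `F`. -/

/-- Convergence of formal power series: every coefficient is eventually constant, with the
coefficient of the limit as its eventual value. -/
def FormalTendsto {R : Type*} [CommRing R] (F : ℕ → PowerSeries (PowerSeries R))
    (G : PowerSeries (PowerSeries R)) : Prop :=
  ∀ a b : ℕ, ∃ N : ℕ, ∀ r : ℕ, N < r →
    ((F r).coeff b).coeff a = (G.coeff b).coeff a

/-- The binomial coefficient `s (s - 1) ⋯ (s - k + 1) / k!`. -/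
def genBinom {S : Type*} [CommRing S] [Algebra ℚ S] (s : S) (k : ℕ) : S :=
  (k ! : ℚ)⁻¹ • ∏ i ∈ Finset.range k, (s - (i : S))

/-- The power `F ^ s = ∑ₖ (s choose k) (F - 1) ^ k` of a power series `F` with constant
coefficient `1`. The terms with `k > n` do not contribute to the coefficient of `x ^ n`. -/
def formalPow {S : Type*} [CommRing S] [Algebra ℚ S] (F : PowerSeries S) (s : S) :
    PowerSeries S :=
  PowerSeries.mk fun n =>
    ∑ k ∈ Finset.range (n + 1), genBinom s k * ((F - 1) ^ k).coeff n

/-- The number of pairs `i < j` with `f i - f j ∈ A`. -/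
def diffCount (A : Finset ℤ) {n r : ℕ} (f : Fin n → Fin r) : ℕ :=
  (Finset.univ.filter fun p : Fin n × Fin n =>
    p.1 < p.2 ∧ (((f p.1 : ℕ) : ℤ) - ((f p.2 : ℕ) : ℤ)) ∈ A).card

/-- `A_r(t, x) = ∑ₙ (∑_{f : [n] → [r]} t ^ a(f)) x ^ n / n!`. -/
def functionSeries (A : Finset ℤ) (r : ℕ) : PowerSeries (PowerSeries ℚ) :=
  PowerSeries.mk fun n =>
    (n ! : ℚ)⁻¹ • ∑ f : Fin n → Fin r, (PowerSeries.X : PowerSeries ℚ) ^ diffCount A f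

/-- `A_r` is invertible, so that dividing by it is meaningful. -/
theorem isUnit_functionSeries (A : Finset ℤ) (r : ℕ) : IsUnit (functionSeries A r) := by
  rw [PowerSeries.isUnit_iff_constantCoeff, ← PowerSeries.coeff_zero_eq_constantCoeff_apply]
  simp [functionSeries, diffCount]

/-- `1 + q ∑_{n ≥ 1} χ̄(q, t) x ^ n / n!` for the arrangements `deformedBraid A n`, with `q` the
variable of `Polynomial ℚ`. -/
def coboundarySeries (A : Finset ℤ) : PowerSeries (PowerSeries (Polynomial ℚ)) :=
  1 + PowerSeries.C (PowerSeries.C (Polynomial.X : Polynomial ℚ)) *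
    PowerSeries.mk fun n =>
      if 1 ≤ n then
        (n ! : ℚ)⁻¹ •
          (coboundaryPolynomial (deformedBraid A n) : PowerSeries (Polynomial ℚ))
      else 0

end

open scoped Nat

noncomputable section

/-! ### Generating series of functions into a set with a relation -/

/-! Writing `t = 1 + (t - 1)` turns `t ^ a(f)` into a sum of `(t - 1) ^ |B|` over the systems `B` of
equations `x i - x j = a` that `f` satisfies. So everything reduces to counting solutions of
solvable systems. On each component `C` of `B` a solution is unique up to translation, so an
interval of length `l` at least the spread `s_C` admits `l - s_C` placements of `C`.

A product of `c` series `A_l` counts maps into a disjoint union of intervals (`relSeries_sigmaRel`).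
If all lengths are large, its `x ^ n` coefficient involves them only through `∏_C (∑ l - c * s_C)`
(`exists_coeff_prod_functionSeries`), that is, through `c` and `∑ l`. Hence `A_{r+2} A_r` and
`A_{r+1} ^ 2` agree to any given order in `x` for large `r`. The ratios therefore stabilise to a
limit `F`, and `F ^ m A_r` agrees with `A_{r+m}`. Multiplying by further copies of `A_r` and
extrapolating polynomially to `c = 0` removes the spreads, leaving `∑_B m ^ #components * (t - 1) ^
|B|` for `F ^ m` (`exists_limit_functionSeries`).

On the geometric side the rank of `B` is `n - #components` and the full rank is `n - 1`, so `q * χ̄`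
is the same sum with `q` for `m`. Both sides are coefficientwise polynomial in `q`, so agreement at
all natural numbers suffices. -/

open Classical in
/-- The number of pairs `i < j` such that `f i` and `f j` are related. -/
def relCount {V Y : Type*} [Fintype V] [LT V] (R : Y → Y → Prop) (f : V → Y) : ℕ :=
  ∑ i, ∑ j, if i < j ∧ R (f i) (f j) then 1 else 0

/-- The sum of `t ^ relCount R f` over all functions `f` on `V`. -/
def relSum (V : Type*) {Y : Type*} [Fintype V] [DecidableEq V] [LT V] [Fintype Y]
    (R : Y → Y → Prop) : PowerSeries ℚ :=
  ∑ f : V → Y, PowerSeries.X ^ relCount R f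

/-- The exponential generating series of `n ↦ relSum (Fin n) R`. -/
def relSeries {Y : Type*} [Fintype Y] (R : Y → Y → Prop) : PowerSeries (PowerSeries ℚ) :=
  PowerSeries.mk fun n => (n ! : ℚ)⁻¹ • relSum (Fin n) R

/-- Only the order type of the index set enters, so a subset of `Fin n` may be replaced by `Fin` of
its cardinality. -/
theorem relSum_congr_orderIso {V W Y : Type*} [Fintype V] [DecidableEq V] [Preorder V]
    [Fintype W] [DecidableEq W] [Preorder W] [Fintype Y] (R : Y → Y → Prop) (e : V ≃o W) :
    relSum V R = relSum W R := by
  refine Fintype.sum_equiv (e.toEquiv.arrowCongr (Equiv.refl Y)) _ _ fun f => ?_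
  congr 1
  refine Fintype.sum_equiv e.toEquiv _ _ fun i => Fintype.sum_equiv e.toEquiv _ _ fun j => ?_
  have h : ∀ i, e.toEquiv.arrowCongr (Equiv.refl Y) f (e.toEquiv i) = f i :=
    fun i => congrArg f (e.symm_apply_apply i)
  have hlt : e.toEquiv i < e.toEquiv j ↔ i < j := e.lt_iff_lt
  rw [h, h]
  congr 2
  exact propext hlt.symm

theorem relSeries_congr {Y Z : Type*} [Fintype Y] [Fintype Z] {R : Y → Y → Prop}
    {S : Z → Z → Prop} (e : Y → Z) (he : e.Bijective) (h : ∀ y y', R y y' ↔ S (e y) (e y')) :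
    relSeries R = relSeries S := by
  ext1 n
  simp only [relSeries, PowerSeries.coeff_mk]
  congr 1
  refine Fintype.sum_equiv ((Equiv.refl (Fin n)).arrowCongr (Equiv.ofBijective e he)) _ _
    fun f => ?_
  change _ = PowerSeries.X ^ relCount S fun v => e (f v)
  congr 1
  refine Finset.sum_congr rfl fun i _ => Finset.sum_congr rfl fun j _ => ?_
  congr 3
  exact propext (h _ _)

/-- The function that is `g` on `s` and `h` on the complement of `s`. -/
def glue {V Y Z : Type*} [Fintype V] [DecidableEq V] (s : Finset V) (g : s → Y)
    (h : (sᶜ : Finset V) → Z) (v : V) : Y ⊕ Z :=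
  if hv : v ∈ s then Sum.inl (g ⟨v, hv⟩) else Sum.inr (h ⟨v, Finset.mem_compl.2 hv⟩)

theorem glue_mem {V Y Z : Type*} [Fintype V] [DecidableEq V] (s : Finset V) (g : s → Y)
    (h : (sᶜ : Finset V) → Z) (v : s) : glue s g h v = Sum.inl (g v) := by
  simp [glue]

theorem glue_compl {V Y Z : Type*} [Fintype V] [DecidableEq V] (s : Finset V) (g : s → Y)
    (h : (sᶜ : Finset V) → Z) (v : (sᶜ : Finset V)) : glue s g h v = Sum.inr (h v) := by
  have := v.2
  simp only [Finset.mem_compl] at this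
  simp [glue, this]

theorem relCount_glue {V Y Z : Type*} [Fintype V] [DecidableEq V] [LT V] (R : Y → Y → Prop)
    (S : Z → Z → Prop) (s : Finset V) (g : s → Y) (h : (sᶜ : Finset V) → Z) :
    relCount (Sum.LiftRel R S) (glue s g h) = relCount R g + relCount S h := by
  classical
  have split : ∀ F : V → ℕ, ∑ v, F v = ∑ v : s, F v + ∑ v : (sᶜ : Finset V), F v := by
    intro F
    rw [Finset.sum_coe_sort s F, Finset.sum_coe_sort sᶜ F, Finset.sum_add_sum_compl]
  unfold relCount
  rw [split]
  congr 1
  · refine Finset.sum_congr rfl fun i _ => ?_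
    rw [split]
    simp [glue_mem, glue_compl]
  · refine Finset.sum_congr rfl fun i _ => ?_
    rw [split]
    simp [glue_mem, glue_compl]

theorem relSum_sum (V : Type*) {Y Z : Type*} [Fintype V] [DecidableEq V] [LT V] [Fintype Y]
    [Fintype Z] (R : Y → Y → Prop) (S : Z → Z → Prop) :
    relSum V (Sum.LiftRel R S) =
      ∑ s : Finset V, relSum s R * relSum (sᶜ : Finset V) S := by
  classical
  unfold relSum
  rw [← Finset.sum_fiberwise (s := Finset.univ)
    (g := fun f : V → Y ⊕ Z => Finset.univ.filter fun v => (f v).isLeft)]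
  refine Finset.sum_congr rfl fun s _ => ?_
  rw [Finset.sum_mul_sum, ← Finset.sum_product']
  symm
  refine Finset.sum_bij (fun gh _ => glue s gh.1 gh.2) ?_ ?_ ?_ ?_
  · rintro ⟨g, h⟩ -
    simp only [Finset.mem_filter, Finset.mem_univ, true_and]
    ext v
    rw [Finset.mem_filter]
    by_cases hv : v ∈ s <;> simp [glue, hv]
  · rintro ⟨g, h⟩ - ⟨g', h'⟩ - heq
    refine Prod.ext (funext fun v => ?_) (funext fun v => ?_)
    · have := congrFun heq v
      simpa [glue_mem] using this
    · have := congrFun heq v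
      simpa [glue_compl] using this
  · intro f hf
    simp only [Finset.mem_filter, Finset.mem_univ, true_and] at hf
    have hs : ∀ v, v ∈ s ↔ (f v).isLeft := fun v => by
      rw [← hf, Finset.mem_filter]
      simp
    have hl : ∀ v : s, (f v).isLeft := fun v => (hs v).1 v.2
    have hr : ∀ v : (sᶜ : Finset V), (f v).isRight := fun v => by
      have := Finset.mem_compl.1 v.2
      rw [hs] at this
      simpa using this
    refine ⟨(fun v => (f v).getLeft (hl v), fun v => (f v).getRight (hr v)), by simp, ?_⟩
    funext v
    by_cases hv : v ∈ s <;> simp [glue, hv]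
  · rintro ⟨g, h⟩ -
    rw [relCount_glue, pow_add]

/-- Elements of different summands are never related, so a map splits into independent maps on the
preimages of the two summands. The choice of the preimage gives the binomial coefficient of an
exponential product. -/
theorem relSeries_sum {Y Z : Type*} [Fintype Y] [Fintype Z] (R : Y → Y → Prop)
    (S : Z → Z → Prop) : relSeries (Sum.LiftRel R S) = relSeries R * relSeries S := by
  ext1 n
  rw [PowerSeries.coeff_mul]
  simp only [relSeries, PowerSeries.coeff_mk]
  have key : ∀ s : Finset (Fin n), relSum s R * relSum (sᶜ : Finset (Fin n)) S =
      relSum (Fin s.card) R * relSum (Fin (n - s.card)) S := by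
    intro s
    rw [relSum_congr_orderIso R (s.orderIsoOfFin rfl),
      relSum_congr_orderIso S (sᶜ.orderIsoOfFin (by rw [Finset.card_compl, Fintype.card_fin]))]
  rw [relSum_sum, Finset.sum_congr rfl fun s _ => key s, ← Finset.powerset_univ,
    Finset.sum_powerset_apply_card fun k => relSum (Fin k) R * relSum (Fin (n - k)) S,
    Finset.card_univ, Fintype.card_fin,
    Finset.Nat.sum_antidiagonal_eq_sum_range_succ
      (fun i j => ((i ! : ℚ)⁻¹ • relSum (Fin i) R) * ((j ! : ℚ)⁻¹ • relSum (Fin j) S)),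
    Finset.smul_sum]
  refine Finset.sum_congr rfl fun k hk => ?_
  have hk' : k ≤ n := Nat.lt_succ_iff.1 (Finset.mem_range.1 hk)
  rw [smul_mul_smul_comm, ← Nat.cast_smul_eq_nsmul ℚ, smul_smul, Nat.cast_choose ℚ hk']
  congr 1
  have := Nat.factorial_ne_zero n
  field_simp

/-! ### Disjoint unions of intervals -/

/-- Two elements of a disjoint union of intervals are related if they belong to the same
interval and their difference belongs to `A`. -/
def sigmaRel (A : Finset ℤ) {c : ℕ} (l : Fin c → ℕ) (y z : Σ k, Fin (l k)) : Prop :=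
  y.1 = z.1 ∧ (((y.2 : ℕ) : ℤ) - ((z.2 : ℕ) : ℤ)) ∈ A

theorem relSeries_eq_functionSeries (A : Finset ℤ) (r : ℕ) :
    relSeries (fun u v : Fin r => (((u : ℕ) : ℤ) - ((v : ℕ) : ℤ)) ∈ A) = functionSeries A r := by
  ext1 n
  simp only [relSeries, functionSeries, relSum, PowerSeries.coeff_mk]
  congr 1
  refine Finset.sum_congr rfl fun f _ => ?_
  congr 1
  rw [relCount, diffCount, Finset.card_filter, Fintype.sum_prod_type]
  exact Finset.sum_congr rfl fun i _ => Finset.sum_congr rfl fun j _ => by congr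

theorem relSeries_sigmaRel (A : Finset ℤ) {c : ℕ} (l : Fin c → ℕ) :
    relSeries (sigmaRel A l) = ∏ k, functionSeries A (l k) := by
  induction c with
  | zero =>
    ext1 n
    rcases n with _ | n
    · simp [relSeries, relSum, relCount]
    · simp [relSeries, relSum, PowerSeries.coeff_one]
  | succ c ih =>
    rw [Fin.prod_univ_succ, ← ih fun k => l k.succ, ← relSeries_eq_functionSeries,
      ← relSeries_sum]
    symm
    refine relSeries_congr
      (Sum.elim (fun v => ⟨0, v⟩) fun y => ⟨y.1.succ, y.2⟩) ⟨?_, ?_⟩ ?_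
    · rintro (u | ⟨k, u⟩) (v | ⟨k', v⟩) h
      · simpa using h
      · simp only [Sum.elim_inl, Sum.elim_inr, Sigma.mk.injEq] at h
        exact absurd h.1.symm (Fin.succ_ne_zero _)
      · simp only [Sum.elim_inl, Sum.elim_inr, Sigma.mk.injEq] at h
        exact absurd h.1 (Fin.succ_ne_zero _)
      · simp only [Sum.elim_inr, Sigma.mk.injEq, Fin.succ_inj] at h
        obtain ⟨rfl, h⟩ := h
        simpa using h
    · rintro ⟨k, v⟩
      revert v
      refine Fin.cases ?_ (fun k => ?_) k
      · exact fun v => ⟨Sum.inl v, rfl⟩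
      · exact fun v => ⟨Sum.inr ⟨k, v⟩, rfl⟩
    · rintro (u | ⟨k, u⟩) (v | ⟨k', v⟩)
      · simp [sigmaRel]
      · simp [sigmaRel, (Fin.succ_ne_zero _).symm]
      · simp [sigmaRel]
      · simp [sigmaRel]

/-! ### Systems of equations `x i - x j = a` -/

/-- The triples `((i, j), a)` with `i < j` and `a ∈ A`, encoding the equations
`x i - x j = a`. -/
def diffTriples (A : Finset ℤ) (n : ℕ) : Finset ((Fin n × Fin n) × ℤ) :=
  (Finset.univ.filter fun p : Fin n × Fin n => p.1 < p.2) ×ˢ A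

/-- A system of equations `x i - x j = a` is solvable over the integers. -/
def IsSolvableSystem {n : ℕ} (B : Finset ((Fin n × Fin n) × ℤ)) : Prop :=
  ∃ p : Fin n → ℤ, ∀ e ∈ B, p e.1.1 - p e.1.2 = e.2

open Classical in
/-- The subsystems of `diffTriples A n` that are solvable over the integers. -/
def solvableSystems (A : Finset ℤ) (n : ℕ) : Finset (Finset ((Fin n × Fin n) × ℤ)) :=
  (diffTriples A n).powerset.filter IsSolvableSystem

/-- The equivalence relation generated by `i ~ j` for the equations `x i - x j = a` in `B`. -/
def componentSetoid {n : ℕ} (B : Finset ((Fin n × Fin n) × ℤ)) : Setoid (Fin n) :=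
  Relation.EqvGen.setoid fun i j => ∃ a, ((i, j), a) ∈ B

/-- The connected components of a system of equations. -/
def Components {n : ℕ} (B : Finset ((Fin n × Fin n) × ℤ)) : Type :=
  Quotient (componentSetoid B)

/-- The connected component of an index. -/
def toComponent {n : ℕ} (B : Finset ((Fin n × Fin n) × ℤ)) (v : Fin n) : Components B :=
  Quotient.mk _ v

theorem toComponent_surjective {n : ℕ} (B : Finset ((Fin n × Fin n) × ℤ)) :
    Function.Surjective (toComponent B) :=
  Quotient.mk_surjective

instance {n : ℕ} (B : Finset ((Fin n × Fin n) × ℤ)) : Finite (Components B) :=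
  Finite.of_surjective _ (toComponent_surjective B)

instance {n : ℕ} (B : Finset ((Fin n × Fin n) × ℤ)) : Fintype (Components B) :=
  Fintype.ofFinite _

instance {n : ℕ} (B : Finset ((Fin n × Fin n) × ℤ)) : DecidableEq (Components B) :=
  Classical.decEq _

theorem toComponent_eq {n : ℕ} {B : Finset ((Fin n × Fin n) × ℤ)} {e : (Fin n × Fin n) × ℤ}
    (he : e ∈ B) : toComponent B e.1.1 = toComponent B e.1.2 :=
  Quotient.sound (Relation.EqvGen.rel _ _ ⟨e.2, he⟩)

theorem exists_eq_comp_toComponent {n : ℕ} {B : Finset ((Fin n × Fin n) × ℤ)} {α : Type*}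
    (g : Fin n → α) (hg : ∀ e ∈ B, g e.1.1 = g e.1.2) :
    ∃ h : Components B → α, ∀ v, g v = h (toComponent B v) := by
  refine ⟨Quotient.lift g fun i j hij => ?_, fun v => rfl⟩
  have hij' : Relation.EqvGen (fun i j => ∃ a, ((i, j), a) ∈ B) i j := hij
  induction hij' with
  | rel i j h => obtain ⟨a, h⟩ := h; exact hg _ h
  | refl => rfl
  | symm i j h ih => exact (ih h).symm
  | trans i j k h h' ih ih' => exact (ih h).trans (ih' h')

/-- The equation `x i - x j = a` holds for a function into a disjoint union of intervals. -/
def SigmaEq {n c : ℕ} {l : Fin c → ℕ} (f : Fin n → Σ k, Fin (l k))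
    (e : (Fin n × Fin n) × ℤ) : Prop :=
  (f e.1.1).1 = (f e.1.2).1 ∧
    (((f e.1.1).2 : ℕ) : ℤ) - (((f e.1.2).2 : ℕ) : ℤ) = e.2

theorem exists_component_bounds {n : ℕ} (B : Finset ((Fin n × Fin n) × ℤ)) (p : Fin n → ℤ)
    (C : Components B) : ∃ lo hi : ℤ,
      (∀ v, toComponent B v = C → lo ≤ p v ∧ p v ≤ hi) ∧
      (∃ v, toComponent B v = C ∧ p v = lo) ∧ ∃ v, toComponent B v = C ∧ p v = hi := by
  have hne : (Finset.univ.filter fun v => toComponent B v = C).Nonempty := by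
    obtain ⟨v, hv⟩ := toComponent_surjective B C
    exact ⟨v, by simp [hv]⟩
  obtain ⟨u, hu, hu'⟩ := Finset.exists_min_image _ p hne
  obtain ⟨w, hw, hw'⟩ := Finset.exists_max_image _ p hne
  simp only [Finset.mem_filter, Finset.mem_univ, true_and] at hu hu' hw hw'
  exact ⟨p u, p w, fun v hv => ⟨hu' v hv, hw' v hv⟩, ⟨u, hu, rfl⟩, w, hw, rfl⟩

open Classical in
/-- The number of solutions of a solvable system in a disjoint union of long intervals is a
product over the connected components. -/
theorem exists_card_solutions {n : ℕ} {B : Finset ((Fin n × Fin n) × ℤ)}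
    (hB : IsSolvableSystem B) :
    ∃ N : ℕ, ∃ s : Components B → ℤ, ∀ (c : ℕ) (l : Fin c → ℕ), (∀ k, N ≤ l k) →
      ((Finset.univ.filter fun f : Fin n → Σ k, Fin (l k) => ∀ e ∈ B, SigmaEq f e).card : ℤ) =
        ∏ C, ((∑ k, (l k : ℤ)) - c * s C) := by
  obtain ⟨p, hp⟩ := hB
  choose lo hi hbd hlo hhi using exists_component_bounds B p
  -- The threshold is the largest spread of `p` on a component, so no interval is too short and `l k
  -- - (hi C - lo C)` is never negative.
  refine ⟨Finset.univ.sup fun C => (hi C - lo C).toNat, fun C => hi C - lo C,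
    fun c l hl => ?_⟩
  have hs : ∀ C k, hi C - lo C ≤ l k := fun C k => by
    have h1 := Finset.le_sup (f := fun C => (hi C - lo C).toNat) (Finset.mem_univ C)
    have h2 := hl k
    omega
  -- A placement of `C` is an interval `k` and a shift `d` for which `p + d` maps `C` into `[0, l
  -- k)`. Solutions correspond to independent choices of placements.
  let fit : Components B → Finset (Σ _ : Fin c, ℤ) := fun C =>
    Finset.univ.sigma fun k => Finset.Ico (-lo C) (l k - hi C)
  have hfit : ∀ C, ((fit C).card : ℤ) = (∑ k, (l k : ℤ)) - c * (hi C - lo C) := by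
    intro C
    simp only [fit, Finset.card_sigma, Int.card_Ico]
    push_cast
    rw [Finset.sum_congr rfl fun k _ => show
      (((l k : ℤ) - hi C - -lo C).toNat : ℤ) = (l k : ℤ) - (hi C - lo C) by
        have := hs C k
        omega]
    simp [Finset.sum_sub_distrib]
    ring
  rw [← Finset.prod_congr rfl fun C _ => hfit C, ← Nat.cast_prod, ← Fintype.card_piFinset]
  congr 1
  symm
  have hmem : ∀ g ∈ Fintype.piFinset fit, ∀ v, 0 ≤ (g (toComponent B v)).2 + p v ∧
      (g (toComponent B v)).2 + p v < l (g (toComponent B v)).1 := by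
    intro g hg v
    have h1 := Fintype.mem_piFinset.1 hg (toComponent B v)
    simp only [fit, Finset.mem_sigma, Finset.mem_univ, true_and, Finset.mem_Ico] at h1
    have h2 := hbd _ v rfl
    constructor <;> linarith
  refine Finset.card_bij (fun g hg v => ⟨(g (toComponent B v)).1,
    ⟨((g (toComponent B v)).2 + p v).toNat, by have := hmem g hg v; omega⟩⟩) ?_ ?_ ?_
  · intro g hg
    simp only [Finset.mem_filter, Finset.mem_univ, true_and]
    intro e he
    have h1 := hmem g hg e.1.1
    have h2 := hmem g hg e.1.2
    have h3 := hp e he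
    refine ⟨by simp only [toComponent_eq he], ?_⟩
    simp only [toComponent_eq he] at h1 ⊢
    omega
  · intro g hg g' hg' h
    funext C
    obtain ⟨v, rfl⟩ := toComponent_surjective B C
    have h0 := congrFun h v
    have h1 := congrArg (fun y => y.1) h0
    have h2 := congrArg (fun y => (y.2 : ℕ)) h0
    simp only at h1 h2
    have h3 := hmem g hg v
    have h4 := hmem g' hg' v
    refine Sigma.ext h1 (heq_of_eq ?_)
    omega
  · intro f hf
    simp only [Finset.mem_filter, Finset.mem_univ, true_and] at hf
    obtain ⟨g, hg⟩ := exists_eq_comp_toComponent (B := B)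
      (fun v => (⟨(f v).1, (((f v).2 : ℕ) : ℤ) - p v⟩ : Σ _ : Fin c, ℤ)) fun e he => by
        obtain ⟨h1, h2⟩ := hf e he
        have h3 := hp e he
        refine Sigma.ext h1 (heq_of_eq ?_)
        simp only
        omega
    have hg1 : ∀ v, (g (toComponent B v)).1 = (f v).1 := fun v => by rw [← hg]
    have hg2 : ∀ v, (g (toComponent B v)).2 = (((f v).2 : ℕ) : ℤ) - p v := fun v => by rw [← hg]
    refine ⟨g, Fintype.mem_piFinset.2 fun C => ?_, funext fun v => ?_⟩
    · simp only [fit, Finset.mem_sigma, Finset.mem_univ, true_and, Finset.mem_Ico]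
      obtain ⟨u, hu, hu'⟩ := hlo C
      obtain ⟨w, hw, hw'⟩ := hhi C
      have e1 := hg2 u
      have e2 := hg2 w
      have e3 := hg1 w
      rw [hu] at e1
      rw [hw] at e2 e3
      have e4 := (f w).2.2
      rw [e2]
      constructor
      · omega
      · rw [e3]; omega
    · refine Sigma.ext (hg1 v) ?_
      have e1 := hg1 v
      have e2 := hg2 v
      rw [Fin.heq_ext_iff (by rw [e1])]
      simp only
      omega

open Classical in
theorem relCount_sigmaRel (A : Finset ℤ) {n c : ℕ} {l : Fin c → ℕ}
    (f : Fin n → Σ k, Fin (l k)) :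
    relCount (sigmaRel A l) f = ((diffTriples A n).filter (SigmaEq f)).card := by
  rw [Finset.card_filter, diffTriples, Finset.sum_product, Finset.sum_filter, relCount,
    Fintype.sum_prod_type]
  refine Finset.sum_congr rfl fun i _ => Finset.sum_congr rfl fun j _ => ?_
  by_cases hij : i < j
  · by_cases hk : (f i).1 = (f j).1
    · simp [hij, hk, sigmaRel, SigmaEq]
    · simp [hij, hk, sigmaRel, SigmaEq]
  · simp [hij]

-- Expand `X ^ m = ((X - 1) + 1) ^ m` over subsets of the equations satisfied by `f`. Such a subset
-- is automatically solvable, by the positions of `f` inside its intervals.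
open Classical in
theorem relSum_sigmaRel (A : Finset ℤ) (n : ℕ) {c : ℕ} (l : Fin c → ℕ) :
    relSum (Fin n) (sigmaRel A l) = ∑ B ∈ solvableSystems A n,
      (Finset.univ.filter fun f : Fin n → Σ k, Fin (l k) => ∀ e ∈ B, SigmaEq f e).card •
        (PowerSeries.X - 1 : PowerSeries ℚ) ^ B.card := by
  have h1 : ∀ f : Fin n → Σ k, Fin (l k),
      (PowerSeries.X : PowerSeries ℚ) ^ relCount (sigmaRel A l) f =
        ∑ B ∈ solvableSystems A n, if ∀ e ∈ B, SigmaEq f e then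
          (PowerSeries.X - 1 : PowerSeries ℚ) ^ B.card else 0 := by
    intro f
    have h2 := Finset.sum_pow_mul_eq_add_pow (PowerSeries.X - 1 : PowerSeries ℚ) 1
      ((diffTriples A n).filter (SigmaEq f))
    rw [sub_add_cancel] at h2
    rw [relCount_sigmaRel, ← h2, ← Finset.sum_filter]
    refine Finset.sum_congr ?_ fun B _ => by simp
    ext B
    simp only [solvableSystems, Finset.mem_powerset, Finset.mem_filter,
      Finset.subset_iff]
    constructor
    · intro h
      exact ⟨⟨fun e he => (h he).1, fun v => (((f v).2 : ℕ) : ℤ), fun e he => (h he).2.2⟩,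
        fun e he => (h he).2⟩
    · exact fun h e he => ⟨h.1.1 he, h.2 e he⟩
  rw [relSum, Finset.sum_congr rfl fun f _ => h1 f, Finset.sum_comm]
  refine Finset.sum_congr rfl fun B _ => ?_
  rw [← Finset.sum_filter, Finset.sum_const]

/-- For long intervals, the coefficients of a product of the series `functionSeries A (l k)` only
depend on the number of factors and on the sum of the lengths `l k`, through a product over the
connected components. -/
theorem exists_coeff_prod_functionSeries (A : Finset ℤ) (n : ℕ) :
    ∃ N : ℕ, ∃ s : ∀ B : Finset ((Fin n × Fin n) × ℤ), Components B → ℤ,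
      ∀ (c : ℕ) (l : Fin c → ℕ), (∀ k, N ≤ l k) →
        (∏ k, functionSeries A (l k)).coeff n =
          (n ! : ℚ)⁻¹ • ∑ B ∈ solvableSystems A n,
            (((∏ C, ((∑ k, (l k : ℤ)) - c * s B C) : ℤ) : ℚ)) •
              (PowerSeries.X - 1 : PowerSeries ℚ) ^ B.card := by
  classical
  have h : ∀ B : Finset ((Fin n × Fin n) × ℤ), ∃ N : ℕ, ∃ s : Components B → ℤ,
      IsSolvableSystem B → ∀ (c : ℕ) (l : Fin c → ℕ), (∀ k, N ≤ l k) →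
        ((Finset.univ.filter fun f : Fin n → Σ k, Fin (l k) =>
          ∀ e ∈ B, SigmaEq f e).card : ℤ) = ∏ C, ((∑ k, (l k : ℤ)) - c * s C) := by
    intro B
    by_cases hB : IsSolvableSystem B
    · obtain ⟨N, s, h⟩ := exists_card_solutions hB
      exact ⟨N, s, fun _ => h⟩
    · exact ⟨0, fun _ => 0, fun h => absurd h hB⟩
  choose N s h using h
  refine ⟨(solvableSystems A n).sup N, s, fun c l hl => ?_⟩
  rw [← relSeries_sigmaRel, relSeries, PowerSeries.coeff_mk, relSum_sigmaRel]
  congr 1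
  refine Finset.sum_congr rfl fun B hB => ?_
  rw [← h B (Finset.mem_filter.1 hB).2 c l fun k => (Finset.le_sup hB).trans (hl k),
    Int.cast_natCast, Nat.cast_smul_eq_nsmul]

/-! ### Powers of formal power series -/

theorem genBinom_natCast {S : Type*} [CommRing S] [Algebra ℚ S] (m k : ℕ) :
    genBinom (m : S) k = (m.choose k : S) := by
  have h := descPochhammer_eval_eq_descFactorial S m k
  rw [descPochhammer_eval_eq_prod_range, Nat.descFactorial_eq_factorial_mul_choose] at h
  rw [genBinom, h, Nat.cast_mul, inv_smul_eq_iff₀ (by exact_mod_cast k.factorial_ne_zero),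
    Nat.cast_smul_eq_nsmul, nsmul_eq_mul]

/-- This is the binomial theorem for `(F - 1) + 1`. The two truncations agree: terms with `k > m`
have zero binomial coefficient, and those with `k > n` vanish since `X` divides `F - 1`. -/
theorem formalPow_natCast {S : Type*} [CommRing S] [Algebra ℚ S] {F : PowerSeries S}
    (hF : PowerSeries.constantCoeff F = 1) (m : ℕ) : formalPow F (m : S) = F ^ m := by
  ext n
  have hX : PowerSeries.X ∣ F - 1 := by
    rw [PowerSeries.X_dvd_iff]
    simp [hF]
  have hzero : ∀ k, n < k → ((F - 1) ^ k).coeff n = 0 := fun k hk =>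
    PowerSeries.X_pow_dvd_iff.1 (pow_dvd_pow_of_dvd hX k) n hk
  have h := add_pow (F - 1) 1 m
  rw [sub_add_cancel] at h
  rw [h, map_sum, formalPow, PowerSeries.coeff_mk]
  rw [Finset.sum_subset (Finset.range_mono (show n + 1 ≤ n + m + 1 by omega)),
    Finset.sum_subset (Finset.range_mono (show m + 1 ≤ n + m + 1 by omega))]
  · refine Finset.sum_congr rfl fun k _ => ?_
    rw [genBinom_natCast, one_pow, mul_one, ← nsmul_eq_mul, ← nsmul_eq_mul', map_nsmul]
  · intro k _ hk
    rw [Nat.choose_eq_zero_of_lt (by simpa using hk)]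
    simp
  · intro k _ hk
    rw [hzero k (by simpa using hk), mul_zero]

theorem map_formalPow {S S' : Type*} [CommRing S] [Algebra ℚ S] [CommRing S'] [Algebra ℚ S']
    (f : S →+* S') (F : PowerSeries S) (s : S) :
    PowerSeries.map f (formalPow F s) = formalPow (PowerSeries.map f F) (f s) := by
  ext n
  simp only [formalPow, genBinom, PowerSeries.coeff_map, PowerSeries.coeff_mk, map_sum, map_mul,
    map_rat_smul, map_prod, map_sub, map_natCast]
  refine Finset.sum_congr rfl fun k _ => ?_
  rw [← PowerSeries.coeff_map, map_pow, map_sub, map_one]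

theorem map_eval_map_C (F : PowerSeries (PowerSeries ℚ)) (x : ℚ) :
    PowerSeries.map (PowerSeries.map (Polynomial.evalRingHom x))
      (PowerSeries.map (PowerSeries.map Polynomial.C) F) = F := by
  ext n j
  simp

theorem map_eval_formalPow {F : PowerSeries (PowerSeries ℚ)}
    (hF : PowerSeries.constantCoeff F = 1) (m : ℕ) :
    PowerSeries.map (PowerSeries.map (Polynomial.evalRingHom (m : ℚ)))
      (formalPow (PowerSeries.map (PowerSeries.map Polynomial.C) F)
        (PowerSeries.C (Polynomial.X : Polynomial ℚ))) = F ^ m := by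
  rw [map_formalPow, map_eval_map_C, ← formalPow_natCast hF]
  congr 1
  simp

/-- The coefficients of `V * U ^ a` are polynomial functions of `a`. -/
theorem exists_polynomial_coeff_mul_pow (V : PowerSeries (PowerSeries ℚ))
    {U : PowerSeries (PowerSeries ℚ)} (hU : PowerSeries.constantCoeff U = 1) (n j : ℕ) :
    ∃ p : Polynomial ℚ, ∀ a : ℕ, p.eval (a : ℚ) = ((V * U ^ a).coeff n).coeff j := by
  refine ⟨((PowerSeries.map (PowerSeries.map Polynomial.C) V *
    formalPow (PowerSeries.map (PowerSeries.map Polynomial.C) U)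
      (PowerSeries.C (Polynomial.X : Polynomial ℚ))).coeff n).coeff j, fun a => ?_⟩
  rw [← map_eval_formalPow hU a]
  nth_rw 2 [← map_eval_map_C V a]
  rw [← map_mul, PowerSeries.coeff_map, PowerSeries.coeff_map, Polynomial.coe_evalRingHom]

/-! ### The limit of the quotients -/

theorem constantCoeff_functionSeries (A : Finset ℤ) (r : ℕ) :
    PowerSeries.constantCoeff (functionSeries A r) = 1 := by
  rw [← PowerSeries.coeff_zero_eq_constantCoeff_apply]
  simp [functionSeries, diffCount]

/-- The ratios of consecutive series `functionSeries A r` converge, and the coefficients of the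
powers of the limit are sums over solvable systems of equations. -/
theorem exists_limit_functionSeries (A : Finset ℤ) :
    ∃ F : PowerSeries (PowerSeries ℚ),
      FormalTendsto
        (fun r : ℕ => functionSeries A (r + 1) * Ring.inverse (functionSeries A r)) F ∧
      PowerSeries.constantCoeff F = 1 ∧
      ∀ m n : ℕ, (F ^ m).coeff n = (n ! : ℚ)⁻¹ • ∑ B ∈ solvableSystems A n,
        ((m : ℚ) ^ Fintype.card (Components B)) •
          (PowerSeries.X - 1 : PowerSeries ℚ) ^ B.card := by
  choose N₀ s h₀ using exists_coeff_prod_functionSeries A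
  set U := functionSeries A with hU
  -- The supremum over all degrees up to `n` gives control modulo `X ^ (n + 1)`, and makes `N`
  -- monotone.
  set N : ℕ → ℕ := fun n => (Finset.range (n + 1)).sup N₀ with hN
  have hN₀ : ∀ {i n}, i ≤ n → N₀ i ≤ N n := fun {i n} hi =>
    Finset.le_sup (f := N₀) (Finset.mem_range.2 (Nat.lt_succ_of_le hi))
  have hmono : ∀ {i n}, i ≤ n → N i ≤ N n := fun {i n} hi =>
    Finset.sup_mono (Finset.range_mono (Nat.succ_le_succ hi))
  set G : ℕ → PowerSeries (PowerSeries ℚ) := fun r => U (r + 1) * Ring.inverse (U r) with hG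
  have hunit : ∀ r, IsUnit (U r) := isUnit_functionSeries A
  have hGU : ∀ r, G r * U r = U (r + 1) := fun r => by
    simp only [hG, mul_assoc, Ring.inverse_mul_cancel _ (hunit r), mul_one]
  -- Both products have two factors and total length `2 * r + 2`.
  have hsq : ∀ n r, N n ≤ r →
      PowerSeries.X ^ (n + 1) ∣ U (r + 2) * U r - U (r + 1) * U (r + 1) := by
    intro n r hr
    rw [PowerSeries.X_pow_dvd_iff]
    intro i hi
    have hi' := (hN₀ (Nat.lt_succ_iff.1 hi)).trans hr
    have h1 := h₀ i 2 ![r + 2, r] (by simp [Fin.forall_fin_two]; omega)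
    have h2 := h₀ i 2 ![r + 1, r + 1] (by simp [Fin.forall_fin_two]; omega)
    simp only [Fin.prod_univ_two, Fin.sum_univ_two, Matrix.cons_val_zero,
      Matrix.cons_val_one] at h1 h2
    rw [map_sub, h1, h2, show ((r + 2 : ℕ) : ℤ) + (r : ℕ) = ((r + 1 : ℕ) : ℤ) + ((r + 1 : ℕ) : ℤ)
      by push_cast; ring, sub_self]
  have hstep : ∀ n r, N n ≤ r → PowerSeries.X ^ (n + 1) ∣ G (r + 1) - G r := by
    intro n r hr
    have h1 : U (r + 2) * U r - U (r + 1) * U (r + 1) =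
        (U (r + 1) * U r) * (G (r + 1) - G r) := by
      have e1 := hGU r
      have e2 := hGU (r + 1)
      rw [show r + 1 + 1 = r + 2 from rfl] at e2
      rw [← e2, mul_sub]
      nth_rw 3 [← e1]
      ring
    have h2 := hsq n r hr
    rw [h1] at h2
    exact ((hunit (r + 1)).mul (hunit r)).dvd_mul_left.1 h2
  have hstable : ∀ n r, N n ≤ r → PowerSeries.X ^ (n + 1) ∣ G r - G (N n) := by
    intro n r hr
    induction r, hr using Nat.le_induction with
    | base => simp
    | succ r hr ih =>
      have := dvd_add (hstep n r hr) ih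
      rwa [sub_add_sub_cancel] at this
  set F : PowerSeries (PowerSeries ℚ) := PowerSeries.mk fun n => (G (N n)).coeff n with hF
  have hcoeff : ∀ n r, N n ≤ r → (G r).coeff n = F.coeff n := by
    intro n r hr
    have := PowerSeries.X_pow_dvd_iff.1 (hstable n r hr) n (Nat.lt_succ_self n)
    rw [map_sub, sub_eq_zero] at this
    rw [this, hF, PowerSeries.coeff_mk]
  have hFG : ∀ n r, N n ≤ r → PowerSeries.X ^ (n + 1) ∣ F - G r := by
    intro n r hr
    rw [PowerSeries.X_pow_dvd_iff]
    intro i hi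
    rw [map_sub, hcoeff i r ((hmono (Nat.lt_succ_iff.1 hi)).trans hr), sub_self]
  have hFU : ∀ n r, N n ≤ r → ∀ m, PowerSeries.X ^ (n + 1) ∣ F ^ m * U r - U (r + m) := by
    intro n r hr m
    induction m with
    | zero => simp
    | succ m ih =>
      have h1 : F ^ (m + 1) * U r - U (r + (m + 1)) =
          F * (F ^ m * U r - U (r + m)) + (F - G (r + m)) * U (r + m) := by
        rw [sub_mul, hGU]
        ring_nf
      rw [h1]
      exact dvd_add (ih.mul_left _) ((hFG n (r + m) (by omega)).mul_right _)
  refine ⟨F, fun a b => ⟨N b, fun r hr => by rw [← hcoeff b r hr.le]⟩, ?_, fun m n => ?_⟩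
  · have h1 := congrArg PowerSeries.constantCoeff (hGU (N 0))
    rw [map_mul, hU, constantCoeff_functionSeries, constantCoeff_functionSeries, mul_one] at h1
    rw [← h1, ← PowerSeries.coeff_zero_eq_constantCoeff_apply,
      ← PowerSeries.coeff_zero_eq_constantCoeff_apply, hcoeff 0 _ le_rfl]
  · ext j
    obtain ⟨p, hp⟩ := exists_polynomial_coeff_mul_pow (F ^ m)
      (constantCoeff_functionSeries A (N n)) n j
    let p' : Polynomial ℚ := Polynomial.C (n ! : ℚ)⁻¹ * ∑ B ∈ solvableSystems A n,
      (∏ C, (Polynomial.C (m : ℚ) + Polynomial.X * Polynomial.C ((N n : ℚ) - s n B C))) *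
        Polynomial.C (((PowerSeries.X - 1 : PowerSeries ℚ) ^ B.card).coeff j)
    -- With `a + 1` intervals, one of length `N n + m` and `a` of length `N n`, each factor is `m +
    -- (a + 1) * (N n - s n B C)`. At least one interval is needed to absorb `m`; the value at `0`,
    -- which is the coefficient of `F ^ m` alone, comes from polynomiality.
    have hpp' : ∀ a : ℕ, p.eval ((a : ℚ) + 1) = p'.eval ((a : ℚ) + 1) := by
      intro a
      have h1 : (F ^ m * U (N n) ^ (a + 1)).coeff n = (U (N n + m) * U (N n) ^ a).coeff n := by
        have h2 := PowerSeries.X_pow_dvd_iff.1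
          ((hFU n (N n) le_rfl m).mul_right (U (N n) ^ a)) n (Nat.lt_succ_self n)
        rw [sub_mul, map_sub, sub_eq_zero] at h2
        rw [← h2, pow_succ', mul_assoc]
      have h3 := h₀ n (a + 1) (Fin.cons (N n + m) fun _ => N n) (by
        have := hN₀ (le_refl n)
        intro k
        refine Fin.cases ?_ (fun k => ?_) k
        · simp only [Fin.cons_zero]; omega
        · simpa only [Fin.cons_succ] using this)
      simp only [Fin.prod_univ_succ, Fin.sum_univ_succ, Fin.cons_zero, Fin.cons_succ,
        Finset.prod_const, Finset.sum_const, Finset.card_univ, Fintype.card_fin] at h3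
      have h4 := hp (a + 1)
      rw [Nat.cast_add, Nat.cast_one] at h4
      rw [h4, ← hU, h1, h3]
      simp only [p', Polynomial.eval_mul, Polynomial.eval_C, Polynomial.eval_finsetSum,
        Polynomial.eval_prod, Polynomial.eval_add, Polynomial.eval_X, map_sum,
        PowerSeries.coeff_smul, smul_eq_mul]
      congr 1
      refine Finset.sum_congr rfl fun B _ => ?_
      congr 1
      rw [Int.cast_prod]
      refine Finset.prod_congr rfl fun C _ => ?_
      push_cast
      rw [nsmul_eq_mul]
      push_cast
      ring
    have heq : p = p' := by
      refine Polynomial.eq_of_infinite_eval_eq _ _ (Set.infinite_of_injective_forall_mem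
        (f := fun a : ℕ => (a : ℚ) + 1) (fun a b hab => ?_) hpp')
      simpa using hab
    have h5 := hp 0
    rw [pow_zero, mul_one, heq] at h5
    rw [← h5]
    simp [p', Polynomial.eval_finsetSum, Polynomial.eval_prod]

/-! ### The arrangement `deformedBraid A n` -/

theorem card_components_le {n : ℕ} (B : Finset ((Fin n × Fin n) × ℤ)) :
    Fintype.card (Components B) ≤ n := by
  simpa using Fintype.card_le_of_surjective _ (toComponent_surjective B)

theorem card_components_pos {n : ℕ} (hn : 1 ≤ n) (B : Finset ((Fin n × Fin n) × ℤ)) :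
    1 ≤ Fintype.card (Components B) :=
  Fintype.card_pos_iff.2 ⟨toComponent B ⟨0, hn⟩⟩

/-- The hyperplane of the equation `x i - x j = a`. -/
def tripleHyperplane {n : ℕ} (e : (Fin n × Fin n) × ℤ) : AffineSubspace ℝ (Fin n → ℝ) :=
  diffHyperplane e.1.1 e.1.2 (e.2 : ℝ)

theorem mem_tripleHyperplane {n : ℕ} {e : (Fin n × Fin n) × ℤ} {x : Fin n → ℝ} :
    x ∈ tripleHyperplane e ↔ x e.1.1 - x e.1.2 = e.2 :=
  Iff.rfl

open Classical in
theorem deformedBraid_eq_image (A : Finset ℤ) (n : ℕ) :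
    deformedBraid A n = (diffTriples A n).image tripleHyperplane := by
  unfold deformedBraid diffTriples tripleHyperplane
  congr

theorem tripleHyperplane_injOn (A : Finset ℤ) (n : ℕ) :
    Set.InjOn tripleHyperplane (diffTriples A n : Set ((Fin n × Fin n) × ℤ)) := by
  rintro ⟨⟨i, j⟩, a⟩ he ⟨⟨k, l⟩, b⟩ he' heq
  simp only [diffTriples, Finset.coe_product, Finset.coe_filter, Finset.mem_univ, true_and,
    Set.mem_prod, Set.mem_ofPred_eq, Finset.mem_coe] at he he'
  have hij := he.1
  have hkl := he'.1
  have hmem : ∀ x : Fin n → ℝ, x i - x j = a → x k - x l = b := fun x hx => by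
    have h1 : x ∈ tripleHyperplane ((i, j), a) := hx
    rw [heq] at h1
    exact h1
  have h0 : (Pi.single i (a : ℝ) : Fin n → ℝ) k - (Pi.single i (a : ℝ) : Fin n → ℝ) l = b :=
    hmem _ (by simp [hij.ne'])
  -- Moving along the `m`-th axis stays on the first hyperplane, hence must preserve `x k - x l`.
  have hm : ∀ m, m ≠ i → m ≠ j → m ≠ k ∧ m ≠ l := by
    intro m hi hj
    have h1 := hmem (Pi.single i (a : ℝ) + Pi.single m 1) (by
      simp [hij.ne', hi.symm, hj.symm])
    simp only [Pi.add_apply] at h1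
    have h2 : (Pi.single m (1 : ℝ) : Fin n → ℝ) k = (Pi.single m (1 : ℝ) : Fin n → ℝ) l := by
      linarith
    constructor
    · rintro rfl
      simp [hkl.ne'] at h2
    · rintro rfl
      simp [hkl.ne] at h2
  have hk : k = i ∨ k = j := by
    by_contra! h
    exact (hm k h.1 h.2).1 rfl
  have hl : l = i ∨ l = j := by
    by_contra! h
    exact (hm l h.1 h.2).2 rfl
  have hki : k = i := by
    rcases hk with h | h
    · exact h
    · rcases hl with h' | h' <;> subst h <;> subst h'
      · exact absurd hij hkl.asymm
      · exact absurd hkl (lt_irrefl _)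
  have hlj : l = j := by
    rcases hl with h | h
    · subst hki; subst h
      exact absurd hkl (lt_irrefl _)
    · exact h
  subst hki
  subst hlj
  simp only [Pi.single_eq_same, Pi.single_eq_of_ne hij.ne', sub_zero, Int.cast_inj] at h0
  rw [h0]

open Classical in
theorem isCentral_image {n : ℕ} (B : Finset ((Fin n × Fin n) × ℤ)) :
    IsCentral (B.image tripleHyperplane) ↔ IsSolvableSystem B := by
  constructor
  · rintro ⟨p, hp⟩
    -- Taking floors preserves integer differences.
    refine ⟨fun v => ⌊p v⌋, fun e he => ?_⟩
    have h := mem_tripleHyperplane.1 (hp _ (Finset.mem_image_of_mem _ he))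
    rw [sub_eq_iff_eq_add'] at h
    simp only [h, Int.floor_add_intCast, add_sub_cancel_left]
  · rintro ⟨p, hp⟩
    refine ⟨fun v => (p v : ℝ), fun H hH => ?_⟩
    obtain ⟨e, he, rfl⟩ := Finset.mem_image.1 hH
    rw [mem_tripleHyperplane, ← hp e he]
    push_cast
    rfl

-- The directions of the intersection are the vectors constant on every component.
open Classical in
theorem centralRank_image {n : ℕ} {B : Finset ((Fin n × Fin n) × ℤ)}
    (hB : IsSolvableSystem B) :
    centralRank (B.image tripleHyperplane) = n - Fintype.card (Components B) := by
  obtain ⟨p, hp⟩ := (isCentral_image B).2 hB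
  have hmem : ∀ x : Fin n → ℝ,
      x ∈ (⨅ H ∈ B.image tripleHyperplane, H : AffineSubspace ℝ (Fin n → ℝ)) ↔
        ∀ e ∈ B, x e.1.1 - x e.1.2 = e.2 := by
    intro x
    simp only [AffineSubspace.mem_iInf_iff, Finset.forall_mem_image, mem_tripleHyperplane]
  have hp' : ∀ e ∈ B, p e.1.1 - p e.1.2 = e.2 := fun e he =>
    mem_tripleHyperplane.1 (hp _ (Finset.mem_image_of_mem _ he))
  have hdir : (⨅ H ∈ B.image tripleHyperplane, H : AffineSubspace ℝ (Fin n → ℝ)).direction =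
      LinearMap.range (LinearMap.funLeft ℝ ℝ (toComponent B)) := by
    ext v
    rw [← AffineSubspace.vadd_mem_iff_mem_direction v ((hmem p).2 hp'), hmem,
      LinearMap.mem_range]
    constructor
    · intro h
      obtain ⟨g, hg⟩ := exists_eq_comp_toComponent (B := B) v fun e he => by
        have h1 := h e he
        have h2 := hp' e he
        simp only [vadd_eq_add, Pi.add_apply] at h1
        linarith
      exact ⟨g, funext fun i => (hg i).symm⟩
    · rintro ⟨g, rfl⟩ e he
      have h2 := hp' e he
      simp only [vadd_eq_add, Pi.add_apply, LinearMap.funLeft_apply, toComponent_eq he]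
      linarith
  rw [centralRank, hdir, LinearMap.finrank_range_of_inj
    (LinearMap.funLeft_injective_of_surjective ℝ ℝ _ (toComponent_surjective B)),
    Module.finrank_fintype_fun_eq_card]

open Classical in
theorem mem_centralSubsets_deformedBraid {A : Finset ℤ} {n : ℕ}
    {E : Finset (AffineSubspace ℝ (Fin n → ℝ))} :
    E ∈ centralSubsets (deformedBraid A n) ↔
      ∃ B ∈ solvableSystems A n, B.image tripleHyperplane = E := by
  rw [centralSubsets, Finset.mem_filter, Finset.mem_powerset, deformedBraid_eq_image,
    Finset.subset_image_iff]
  constructor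
  · rintro ⟨⟨B, hB, rfl⟩, hE⟩
    exact ⟨B, Finset.mem_filter.2 ⟨Finset.mem_powerset.2 hB, (isCentral_image B).1 hE⟩, rfl⟩
  · rintro ⟨B, hB, rfl⟩
    obtain ⟨hB, hB'⟩ := Finset.mem_filter.1 hB
    exact ⟨⟨B, Finset.mem_powerset.1 hB, rfl⟩, (isCentral_image B).2 hB'⟩

/-- There is a solvable system with a single component. -/
theorem exists_card_components_eq_one {A : Finset ℤ} (hA : A.Nonempty) {n : ℕ} (hn : 1 ≤ n) :
    ∃ B ∈ solvableSystems A n, Fintype.card (Components B) = 1 := by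
  classical
  obtain ⟨a, ha⟩ := hA
  let z : Fin n := ⟨0, hn⟩
  let B : Finset ((Fin n × Fin n) × ℤ) :=
    (Finset.univ.filter fun j => z < j).image fun j => ((z, j), a)
  have hB : ∀ e ∈ B, e.1.1 = z ∧ z < e.1.2 ∧ e.2 = a := by
    intro e he
    obtain ⟨j, hj, rfl⟩ := Finset.mem_image.1 he
    exact ⟨rfl, (Finset.mem_filter.1 hj).2, rfl⟩
  have hz : ∀ j, z < j → ((z, j), a) ∈ B := fun j hj =>
    Finset.mem_image_of_mem _ (by simpa using hj)
  refine ⟨B, Finset.mem_filter.2 ⟨Finset.mem_powerset.2 fun e he => ?_,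
    fun v => if v = z then a else 0, fun e he => ?_⟩, ?_⟩
  · obtain ⟨h1, h2, h3⟩ := hB e he
    simp [diffTriples, h1, h2, h3, ha]
  · obtain ⟨h1, h2, h3⟩ := hB e he
    simp [h1, h2.ne', h3]
  · rw [Fintype.card_eq_one_iff]
    refine ⟨toComponent B z, fun C => ?_⟩
    obtain ⟨v, rfl⟩ := toComponent_surjective B C
    by_cases hv : v = z
    · rw [hv]
    · have : z < v := lt_of_le_of_ne (Fin.mk_le_of_le_val (Nat.zero_le _)) (Ne.symm hv)
      exact (toComponent_eq (hz v this)).symm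

theorem arrangementRank_deformedBraid {A : Finset ℤ} (hA : A.Nonempty) {n : ℕ} (hn : 1 ≤ n) :
    arrangementRank (deformedBraid A n) = n - 1 := by
  classical
  refine le_antisymm (Finset.sup_le fun E hE => ?_) ?_
  · obtain ⟨B, hB, rfl⟩ := mem_centralSubsets_deformedBraid.1 hE
    rw [centralRank_image (Finset.mem_filter.1 hB).2]
    exact Nat.sub_le_sub_left (card_components_pos hn B) n
  · obtain ⟨B, hB, hB'⟩ := exists_card_components_eq_one hA hn
    rw [← hB', ← centralRank_image (Finset.mem_filter.1 hB).2]
    exact Finset.le_sup (f := centralRank) (mem_centralSubsets_deformedBraid.2 ⟨B, hB, rfl⟩)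

/-- The extra factor `q` raises the exponent `(n - 1) - (n - #components)` to the number of
components. -/
theorem coboundaryPolynomial_deformedBraid {A : Finset ℤ} (hA : A.Nonempty) {n : ℕ}
    (hn : 1 ≤ n) :
    Polynomial.C Polynomial.X * coboundaryPolynomial (deformedBraid A n) =
      ∑ B ∈ solvableSystems A n,
        Polynomial.C (Polynomial.X ^ Fintype.card (Components B)) *
          (Polynomial.X - 1) ^ B.card := by
  classical
  have hsub : ∀ B ∈ solvableSystems A n, B ⊆ diffTriples A n := fun B hB =>
    Finset.mem_powerset.1 (Finset.mem_filter.1 hB).1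
  rw [coboundaryPolynomial, Finset.mul_sum, arrangementRank_deformedBraid hA hn]
  symm
  refine Finset.sum_bij (fun B _ => B.image tripleHyperplane)
    (fun B hB => mem_centralSubsets_deformedBraid.2 ⟨B, hB, rfl⟩) ?_ ?_ ?_
  · intro B hB B' hB' h
    exact Finset.image_injOn_powerset_of_injOn (tripleHyperplane_injOn A n)
      (Finset.mem_coe.2 (Finset.mem_powerset.2 (hsub B hB)))
      (Finset.mem_coe.2 (Finset.mem_powerset.2 (hsub B' hB'))) h
  · intro E hE
    obtain ⟨B, hB, h⟩ := mem_centralSubsets_deformedBraid.1 hE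
    exact ⟨B, hB, h⟩
  · intro B hB
    rw [centralRank_image (Finset.mem_filter.1 hB).2, Finset.card_image_of_injOn
      ((tripleHyperplane_injOn A n).mono (Finset.coe_subset.2 (hsub B hB))), ← mul_assoc,
      ← Polynomial.C_mul, ← pow_succ']
    have h1 := card_components_le B
    have h2 := card_components_pos hn B
    rw [show n - 1 - (n - Fintype.card (Components B)) + 1 = Fintype.card (Components B) by
      omega]

/-- The value of `coboundarySeries A` at a rational number `x`. -/
theorem coeff_map_eval_coboundarySeries {A : Finset ℤ} (hA : A.Nonempty) (x : ℚ) (n : ℕ) :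
    (PowerSeries.map (PowerSeries.map (Polynomial.evalRingHom x)) (coboundarySeries A)).coeff n =
      (n ! : ℚ)⁻¹ • ∑ B ∈ solvableSystems A n, (x ^ Fintype.card (Components B)) •
        (PowerSeries.X - 1 : PowerSeries ℚ) ^ B.card := by
  classical
  rw [PowerSeries.coeff_map, coboundarySeries, map_add, PowerSeries.coeff_C_mul,
    PowerSeries.coeff_mk]
  rcases Nat.eq_zero_or_pos n with rfl | hn
  -- In degree `0` the series has the constant `1`, matched by the empty system with no components.
  · have h1 : solvableSystems A 0 = {∅} := by
      ext B
      rw [Finset.mem_singleton]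
      constructor
      · intro _
        exact Finset.eq_empty_of_forall_notMem fun e _ => e.1.1.elim0
      · rintro rfl
        exact Finset.mem_filter.2 ⟨Finset.empty_mem_powerset _, fun _ => 0, by simp⟩
    have h2 : Fintype.card (Components (∅ : Finset ((Fin 0 × Fin 0) × ℤ))) = 0 :=
      Nat.le_zero.1 (card_components_le _)
    simp [h1, h2]
  · have h1 := congrArg (Polynomial.coeToPowerSeries.ringHom (R := Polynomial ℚ))
      (coboundaryPolynomial_deformedBraid hA hn)
    simp only [map_mul, map_sum, map_pow, map_sub, map_one,
      Polynomial.coeToPowerSeries.ringHom_apply, Polynomial.coe_C, Polynomial.coe_X] at h1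
    rw [if_pos (show 1 ≤ n from hn), PowerSeries.coeff_one, if_neg hn.ne', zero_add, mul_smul_comm, h1,
      map_rat_smul, map_sum]
    congr 1
    refine Finset.sum_congr rfl fun B _ => ?_
    simp [PowerSeries.smul_eq_C_mul]

end

theorem mainTheorem2 (A : Finset ℤ) (hA : A.Nonempty) :
    ∃ F : PowerSeries (PowerSeries ℚ),
      FormalTendsto
        (fun r : ℕ => functionSeries A (r + 1) * Ring.inverse (functionSeries A r)) F ∧
      PowerSeries.constantCoeff F = 1 ∧
      coboundarySeries A =
        formalPow (PowerSeries.map (PowerSeries.map Polynomial.C) F)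
          (PowerSeries.C (Polynomial.X : Polynomial ℚ)) := by
  obtain ⟨F, hF, hF1, hFm⟩ := exists_limit_functionSeries A
  refine ⟨F, hF, hF1, ?_⟩
  ext1 n
  ext1 j
  -- Each coefficient is a polynomial in `q`, so it is enough to compare the values at `q = m`,
  -- where the formal power is the ordinary `F ^ m`.
  refine Polynomial.eq_of_infinite_eval_eq _ _ (Set.infinite_of_injective_forall_mem
    (f := fun m : ℕ => (m : ℚ)) Nat.cast_injective fun m => ?_)
  have h : PowerSeries.map (PowerSeries.map (Polynomial.evalRingHom (m : ℚ)))
      (coboundarySeries A) = PowerSeries.map (PowerSeries.map (Polynomial.evalRingHom (m : ℚ)))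
      (formalPow (PowerSeries.map (PowerSeries.map Polynomial.C) F)
        (PowerSeries.C (Polynomial.X : Polynomial ℚ))) := by
    ext1 n
    rw [coeff_map_eval_coboundarySeries hA, map_eval_formalPow hF1, hFm]
  have h' := congrArg (fun S => (S.coeff n).coeff j) h
  simpa only [Set.mem_ofPred_eq, PowerSeries.coeff_map, Polynomial.coe_evalRingHom] using h'
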